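/- A cluster graph is a graph every connected component of which is a complete graph. For $n\ge 1$ let $\mathbf{CG}_{n,1/2}$ be the Erdős–Rényi random graph on $n$ labelled vertices, in which every edge is present independently with probability $1/2$, conditioned on being a cluster graph. Let $\mathbf{D}_{n,1/2}$ be the degree in $\mathbf{CG}_{n,1/2}$ of a vertex chosen uniformly at random, independently of the graph. Then, as $n\to\infty$, $$\frac{\mathbf{D}_{n,1/2}-\mathbb{E}\,\mathbf{D}_{n,1/2}}{\sqrt{\mathrm{Var}(\mathbf{D}_{n,1/2})}}\longrightarrow\mathcal{N}(0,1)\quad\text{in distribution.}$$ Moreover, $\mathbb{E}\,\mathbf{D}_{n,1/2}\sim W(n)$ and $\mathrm{Var}(\mathbf{D}_{n,1/2})\sim W(n)$, where $W(n)$ is the unique positive solution $w$ of $w e^{w}=n$ and $a_n\sim b_n$ means $a_n/b_n\to 1$. -/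

import Mathlib

open MeasureTheory ProbabilityTheory Filter Topology
open scoped unitInterval

noncomputable section

namespace RandomCluster

/-- A cluster graph: every connected component is a clique. -/
def IsClusterGraph {V : Type*} (G : SimpleGraph V) : Prop :=
  ∀ c : G.ConnectedComponent, G.IsClique c.supp

/-- The law of the random cluster graph on `n` labelled vertices with parameter `p`: the law of the
Erdős–Rényi graph (every edge is present independently with probability `p`), conditioned on the
event that the graph is a cluster graph. -/
def randomClusterGraph (n : ℕ) (p : I) : Measure (SimpleGraph (Fin n)) :=
  cond (SimpleGraph.binomialRandom (Fin n) p) {G | IsClusterGraph G}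

/-- The joint law of the random cluster graph and an independent, uniformly chosen vertex. -/
def clusterGraphWithVertex (n : ℕ) (p : I) : Measure (SimpleGraph (Fin n) × Fin n) :=
  (randomClusterGraph n p).prod (uniformOn Set.univ)

open Classical in
/-- The degree of the chosen vertex in the chosen graph, as a real random variable. -/
def vertexDegree (n : ℕ) (x : SimpleGraph (Fin n) × Fin n) : ℝ := (x.1.degree x.2 : ℝ)

/-- The critical edge probability `1/2`. -/
def criticalProb : I := ⟨1 / 2, by norm_num, by norm_num⟩

theorem isClusterGraph_bot {V : Type*} : IsClusterGraph (⊥ : SimpleGraph V) := by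
  intro c x hx y hy hxy
  have h : (⊥ : SimpleGraph V).Reachable x y :=
    SimpleGraph.ConnectedComponent.exact (hx.trans hy.symm)
  exact absurd (SimpleGraph.reachable_bot.mp h) hxy

theorem isClusterGraph_top {V : Type*} : IsClusterGraph (⊤ : SimpleGraph V) :=
  fun _ _ _ _ _ hxy => hxy

/-- The conditioning event has positive probability, for all `n` and `p`. -/
theorem binomialRandom_isClusterGraph_ne_zero (n : ℕ) (p : I) :
    SimpleGraph.binomialRandom (Fin n) p {G | IsClusterGraph G} ≠ 0 := by
  by_cases hp : p = 1
  · subst hp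
    rw [SimpleGraph.binomialRandom_one, Measure.dirac_apply_of_mem]
    · exact one_ne_zero
    · exact isClusterGraph_top
  · intro h
    have hb := measure_mono_null (Set.singleton_subset_iff.mpr
      (isClusterGraph_bot : (⊥ : SimpleGraph (Fin n)) ∈ {G | IsClusterGraph G})) h
    rw [SimpleGraph.binomialRandom_singleton] at hb
    have hq : unitInterval.toNNReal (σ p) ≠ 0 := by
      intro h0
      apply hp
      have h1 : ((unitInterval.toNNReal (σ p) : NNReal) : ℝ) = 0 := by rw [h0]; rfl
      simp only [unitInterval.coe_toNNReal, unitInterval.coe_symm_eq] at h1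
      ext
      simp only [Set.Icc.coe_one]
      linarith
    simp [hq] at hb

instance (n : ℕ) (p : I) : IsProbabilityMeasure (randomClusterGraph n p) :=
  cond_isProbabilityMeasure (binomialRandom_isClusterGraph_ne_zero n p)

instance (n : ℕ) [NeZero n] (p : I) : IsProbabilityMeasure (clusterGraphWithVertex n p) := by
  unfold clusterGraphWithVertex
  infer_instance

instance {V : Type*} [Countable V] : MeasurableSingletonClass (SimpleGraph V) where
  measurableSet_singleton G := by
    have h : ({G} : Set (SimpleGraph V)) = SimpleGraph.edgeSet ⁻¹' {G.edgeSet} := by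
      ext H
      simp
    rw [h]
    exact SimpleGraph.measurable_edgeSet (measurableSet_singleton _)

theorem measurable_vertexDegree (n : ℕ) : Measurable (vertexDegree n) :=
  measurable_of_finite _

theorem existsUnique_lambertW (n : ℕ+) : ∃! w : ℝ, 0 < w ∧ w * Real.exp w = (n : ℕ) := by
  have hn : (1 : ℝ) ≤ ((n : ℕ) : ℝ) := by exact_mod_cast n.pos
  have hmono : ∀ a b : ℝ, 0 < a → a < b → a * Real.exp a < b * Real.exp b := fun a b ha hab =>
    mul_lt_mul hab (Real.exp_le_exp.mpr hab.le) (Real.exp_pos a) (ha.trans hab).le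
  have hivt := intermediate_value_Icc (show (0 : ℝ) ≤ ((n : ℕ) : ℝ) by linarith)
    (f := fun w : ℝ => w * Real.exp w) (by fun_prop)
  have hmem : ((n : ℕ) : ℝ) ∈ Set.Icc (0 * Real.exp 0)
      (((n : ℕ) : ℝ) * Real.exp ((n : ℕ) : ℝ)) := by
    refine ⟨by linarith, ?_⟩
    have : 1 ≤ Real.exp ((n : ℕ) : ℝ) := Real.one_le_exp (by linarith)
    nlinarith
  obtain ⟨w, hw, hwn⟩ := hivt hmem
  have hwn' : w * Real.exp w = (n : ℕ) := hwn
  have hw0 : 0 < w := by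
    rcases hw.1.lt_or_eq with h | h
    · exact h
    · rw [← h, zero_mul] at hwn'
      linarith
  refine ⟨w, ⟨hw0, hwn'⟩, ?_⟩
  rintro v ⟨hv0, hv⟩
  rcases lt_trichotomy v w with h | h | h
  · exact absurd (hmono v w hv0 h) (by rw [hv, hwn']; exact lt_irrefl _)
  · exact h
  · exact absurd (hmono w v hw0 h) (by rw [hv, hwn']; exact lt_irrefl _)

/-- The Lambert function at a positive integer: `W(n)` is the unique positive solution `w` of
`w * exp w = n`. -/
def lambertW (n : ℕ+) : ℝ := (existsUnique_lambertW n).choose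

theorem lambertW_spec (n : ℕ+) : 0 < lambertW n ∧ lambertW n * Real.exp (lambertW n) = (n : ℕ) :=
  (existsUnique_lambertW n).choose_spec.1

/-- The mean of the degree of a uniform vertex of the random cluster graph. -/
def degreeMean (n : ℕ) (p : I) : ℝ := ∫ x, vertexDegree n x ∂(clusterGraphWithVertex n p)

/-- The variance of the degree of a uniform vertex of the random cluster graph. -/
def degreeVar (n : ℕ) (p : I) : ℝ := variance (vertexDegree n) (clusterGraphWithVertex n p)

end RandomCluster

end

/-! At edge probability 1/2 every graph has the same weight, so the conditioned graph is a uniform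
cluster graph, that is, a uniform set partition of the vertices. Dobinski's formula
(`hasSum_sum_fiberGraph`) turns a sum over partitions into a sum over colourings: draw `M` with
probability proportional to `m ^ n / m!` (Stam's distribution), colour the vertices independently
and uniformly with `M` colours, and take the colour classes. Given `M`, the degree of a vertex is
then binomial with parameters `n - 1` and `1 / M` (`integral_pow_degree`).

The random parameter `n / M` is close to `w = W(n)`. This rests on a drift inequality
(`drift_lower_bound`): with `a m = m ^ n / m!` and `g m = n / m - w`, the increment `a (m+1) * g
(m+1) - a m * g m` is at least `a m * (g m ^ 2 / w - 10 * w ^ 3 / n)`. The increments telescope to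
zero, so the mean square of `n / M - w` is at most `10 * w ^ 4 / n` (`integral_sq_sub_le`), which
tends to 0 because `n = w * exp w`.

Hence the degree is nearly Poisson with mean `w`. Its mean and variance are `w + o(1)`
(`tendsto_degreeMean_sub`, `tendsto_degreeVar_sub`), and its characteristic function at small
arguments is close to the Poisson one (`norm_integral_exp_degree_sub_le`). Expanding the Poisson
exponent to second order (`tendsto_poisson_exponent`) and applying Lévy's continuity theorem gives
the normal limit. -/

noncomputable section

namespace RandomCluster

/-! ### Cluster graphs, colourings and Dobinski's formula -/

/-- The graph whose edges join the distinct vertices with the same image under `f`. -/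
def fiberGraph {V α : Type*} (f : V → α) : SimpleGraph V where
  Adj u v := u ≠ v ∧ f u = f v
  symm := ⟨fun _ _ h => ⟨h.1.symm, h.2.symm⟩⟩
  loopless := ⟨fun _ h => h.1 rfl⟩

theorem fiberGraph_reachable {V α : Type*} {f : V → α} {u v : V} :
    (fiberGraph f).Reachable u v ↔ f u = f v := by
  constructor
  · rintro ⟨p⟩
    induction p with
    | nil => rfl
    | cons h _ ih => exact h.2.trans ih
  · intro h
    by_cases huv : u = v
    · rw [huv]
    · exact SimpleGraph.Adj.reachable ⟨huv, h⟩

theorem isClusterGraph_fiberGraph {V α : Type*} (f : V → α) : IsClusterGraph (fiberGraph f) := by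
  intro c x hx y hy hxy
  exact ⟨hxy, fiberGraph_reachable.mp (SimpleGraph.ConnectedComponent.exact (hx.trans hy.symm))⟩

theorem IsClusterGraph.fiberGraph_comp_mk {V α : Type*} {G : SimpleGraph V} (hG : IsClusterGraph G)
    (i : G.ConnectedComponent ↪ α) : fiberGraph (fun v => i (G.connectedComponentMk v)) = G := by
  ext u v
  constructor
  · rintro ⟨huv, h⟩
    have h' := i.injective h
    exact hG (G.connectedComponentMk v) h' rfl huv
  · intro h
    exact ⟨h.ne, congrArg i (SimpleGraph.ConnectedComponent.sound h.reachable)⟩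

-- A colouring induces `G` exactly when it is constant on components and separates them, so such
-- colourings correspond to embeddings of the set of components into the colours.
open Classical in
theorem card_fiberGraph_eq {V : Type*} [Fintype V] [DecidableEq V] {G : SimpleGraph V}
    (hG : IsClusterGraph G) (m : ℕ) : (Finset.univ.filter fun f : V → Fin m => fiberGraph f = G).card =
      m.descFactorial (Fintype.card G.ConnectedComponent) := by
  have h := Fintype.card_embedding_eq (α := G.ConnectedComponent) (β := Fin m)
  rw [Fintype.card_fin] at h
  rw [← h, ← Finset.card_univ]
  symm
  refine Finset.card_bij (fun i _ => fun v => i (G.connectedComponentMk v)) ?_ ?_ ?_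
  · intro i _
    simpa using hG.fiberGraph_comp_mk i
  · intro i _ j _ hij
    ext c
    induction c using SimpleGraph.ConnectedComponent.ind with
    | h v => exact congrArg Fin.val (congrFun hij v)
  · intro f hf
    have hf' : fiberGraph f = G := by simpa using hf
    subst hf'
    have key : ∀ v, f ((fiberGraph f).connectedComponentMk v).out = f v := fun v =>
      fiberGraph_reachable.mp (SimpleGraph.ConnectedComponent.exact (Quot.out_eq _))
    refine ⟨⟨fun c => f c.out, ?_⟩, Finset.mem_univ _, funext key⟩
    intro c d hcd
    have h1 := SimpleGraph.ConnectedComponent.sound (fiberGraph_reachable.mpr hcd)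
    rwa [show (fiberGraph f).connectedComponentMk c.out = c from Quot.out_eq _,
      show (fiberGraph f).connectedComponentMk d.out = d from Quot.out_eq _] at h1

/-- The terms with `m < k` vanish and the others are `1 / (m - k)!`. Since the sum does not depend
on `k`, every cluster graph gets the same total weight in Dobinski's formula, whatever its number of
components. -/
theorem hasSum_descFactorial_div_factorial (k : ℕ) :
    HasSum (fun m : ℕ => (m.descFactorial k : ℝ) / m.factorial) (Real.exp 1) := by
  rw [← hasSum_nat_add_iff' k]
  have h0 : ∑ i ∈ Finset.range k, (i.descFactorial k : ℝ) / i.factorial = 0 := by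
    refine Finset.sum_eq_zero fun i hi => ?_
    rw [Nat.descFactorial_of_lt (Finset.mem_range.mp hi)]
    simp
  rw [h0, sub_zero]
  have h1 : HasSum (fun m : ℕ => (1 : ℝ) ^ m / m.factorial) (Real.exp 1) := by
    rw [Real.exp_eq_exp_ℝ]
    exact NormedSpace.expSeries_div_hasSum_exp (1 : ℝ)
  refine h1.congr_fun fun m => ?_
  have h2 := Nat.factorial_mul_descFactorial (Nat.le_add_left k m)
  rw [Nat.add_sub_cancel] at h2
  have h3 : ((m + k).factorial : ℝ) = m.factorial * (m + k).descFactorial k := by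
    exact_mod_cast h2.symm
  have h4 : ((m + k).factorial : ℝ) ≠ 0 := by positivity
  have h5 : (m.factorial : ℝ) ≠ 0 := by positivity
  rw [one_pow, div_eq_div_iff h4 h5, h3]
  ring

open Classical in
/-- **Dobinski's formula** in weighted form: sums over the cluster graphs on `V` are sums over
colourings of `V`. -/
theorem hasSum_sum_fiberGraph {V 𝕜 : Type*} [Fintype V] [DecidableEq V] [RCLike 𝕜] (F : SimpleGraph V → 𝕜) :
    HasSum (fun m : ℕ => ((m.factorial : 𝕜))⁻¹ * ∑ f : V → Fin m, F (fiberGraph f))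
      ((Real.exp 1 : 𝕜) * ∑ G with IsClusterGraph G, F G) := by
  have h1 : ∀ m : ℕ, ((m.factorial : 𝕜))⁻¹ * ∑ f : V → Fin m, F (fiberGraph f) =
      ∑ G with IsClusterGraph G,
        (((m.descFactorial (Fintype.card G.ConnectedComponent) : ℝ) / m.factorial : ℝ) : 𝕜)
          * F G := by
    intro m
    rw [← Finset.sum_fiberwise_of_maps_to (s := Finset.univ) (g := fun f : V → Fin m => fiberGraph f)
      (t := Finset.univ.filter fun G : SimpleGraph V => IsClusterGraph G)
      (fun f _ => by simpa using isClusterGraph_fiberGraph f), Finset.mul_sum]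
    refine Finset.sum_congr rfl fun G hG => ?_
    rw [Finset.sum_congr rfl (g := fun _ => F G)
      (fun f hf => by rw [(Finset.mem_filter.mp hf).2]), Finset.sum_const,
      card_fiberGraph_eq (Finset.mem_filter.mp hG).2, nsmul_eq_mul]
    push_cast
    ring
  simp_rw [h1, Finset.mul_sum]
  refine hasSum_sum fun G _ => HasSum.mul_right _ ?_
  exact (RCLike.hasSum_ofReal (𝕜 := 𝕜)).mpr (hasSum_descFactorial_div_factorial _)

/-! ### Degrees under a uniform colouring -/

open Classical in
theorem fiberGraph_degree {V α : Type*} [Fintype V] [DecidableEq V] (f : V → α) (v : V) :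
    (fiberGraph f).degree v = ∑ u ∈ Finset.univ.erase v, if f u = f v then 1 else 0 := by
  rw [← SimpleGraph.card_neighborFinset_eq_degree, Finset.sum_boole, Nat.cast_id]
  congr 1
  ext u
  simp only [SimpleGraph.mem_neighborFinset, Finset.mem_filter, Finset.mem_erase, Finset.mem_univ,
    and_true]
  exact ⟨fun h => ⟨h.1.symm, h.2.symm⟩, fun h => ⟨h.1.symm, h.2.symm⟩⟩

open Classical in
/-- The generating function of the degree of a vertex under a uniform colouring. -/
theorem sum_pow_degree_fiberGraph {V R : Type*} [Fintype V] [DecidableEq V] [CommRing R] (m : ℕ) (z : R) (v : V) :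
    ∑ f : V → Fin m, z ^ (fiberGraph f).degree v =
      m * (m - 1 + z) ^ (Fintype.card V - 1) := by
  -- Splitting according to the colour `c` of `v` makes the summand a product over vertices, so that
  -- the sum over colourings factorises.
  have h1 : ∀ f : V → Fin m, z ^ (fiberGraph f).degree v =
      ∑ c : Fin m, ∏ u : V, if u = v then (if f u = c then 1 else 0) else
        (if f u = c then z else 1) := by
    intro f
    have : ∀ c : Fin m, (∏ u : V, if u = v then (if f u = c then (1 : R) else 0) else
        (if f u = c then z else 1)) = if f v = c then z ^ (fiberGraph f).degree v else 0 := by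
      intro c
      rw [← Finset.mul_prod_erase _ _ (Finset.mem_univ v), if_pos rfl]
      by_cases hc : f v = c
      · rw [if_pos hc, if_pos hc, one_mul, fiberGraph_degree, ← Finset.prod_pow_eq_pow_sum]
        refine Finset.prod_congr rfl fun u hu => ?_
        rw [if_neg (Finset.ne_of_mem_erase hu), hc]
        split_ifs <;> simp
      · rw [if_neg hc, if_neg hc, zero_mul]
    simp_rw [this]
    simp
  simp_rw [h1]
  rw [Finset.sum_comm]
  have h2 : ∀ c : Fin m, (∑ f : V → Fin m, ∏ u : V,
      if u = v then (if f u = c then (1 : R) else 0) else (if f u = c then z else 1)) =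
      (m - 1 + z) ^ (Fintype.card V - 1) := by
    intro c
    rw [← Fintype.prod_sum (fun (u : V) (j : Fin m) =>
      if u = v then (if j = c then (1 : R) else 0) else (if j = c then z else 1)),
      ← Finset.mul_prod_erase _ _ (Finset.mem_univ v)]
    have h3 : (∑ j : Fin m, if v = v then (if j = c then (1 : R) else 0) else
        (if j = c then z else 1)) = 1 := by simp
    rw [h3, one_mul, Finset.prod_congr rfl (g := fun _ => (m : R) - 1 + z),
      Finset.prod_const, Finset.card_erase_of_mem (Finset.mem_univ v), Finset.card_univ]
    intro u hu
    have h4 : ∀ j : Fin m, (if u = v then (if j = c then (1 : R) else 0) else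
        (if j = c then z else 1)) = 1 + if j = c then z - 1 else 0 := by
      intro j
      rw [if_neg (Finset.ne_of_mem_erase hu)]
      split_ifs <;> ring
    simp_rw [h4, Finset.sum_add_distrib]
    simp
    ring
  simp_rw [h2]
  simp

/-! ### The uniform law at edge probability 1/2 -/

/-- Edges and non-edges have the same probability, so the weight does not depend on `G`. -/
theorem binomialRandom_criticalProb_singleton (n : ℕ) (G : SimpleGraph (Fin n)) :
    SimpleGraph.binomialRandom (Fin n) criticalProb {G} =
      (unitInterval.toNNReal criticalProb : ENNReal) ^ (n.choose 2) := by
  have h : unitInterval.toNNReal (σ criticalProb) = unitInterval.toNNReal criticalProb := by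
    congr 1
    ext
    simp only [unitInterval.coe_symm_eq, criticalProb]
    norm_num
  have hle : G.edgeSet.ncard ≤ n.choose 2 := by
    classical
    rw [← SimpleGraph.coe_edgeFinset, Set.ncard_coe_finset]
    simpa using G.card_edgeFinset_le_card_choose_two
  rw [SimpleGraph.binomialRandom_singleton, h, ← pow_add, Nat.card_eq_fintype_card,
    Fintype.card_fin, Nat.add_sub_cancel' hle]

open Classical in
/-- The number of cluster graphs on `n` labelled vertices. -/
def clusterCount (n : ℕ) : ℕ :=
  (Finset.univ.filter fun G : SimpleGraph (Fin n) => IsClusterGraph G).card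

theorem clusterCount_pos (n : ℕ) : 0 < clusterCount n :=
  Finset.card_pos.mpr ⟨⊥, by simp [isClusterGraph_bot]⟩

open Classical in
theorem randomClusterGraph_real_singleton (n : ℕ) (G : SimpleGraph (Fin n)) :
    (randomClusterGraph n criticalProb).real {G} =
      if IsClusterGraph G then ((clusterCount n : ℝ))⁻¹ else 0 := by
  have hmeas : MeasurableSet {G : SimpleGraph (Fin n) | IsClusterGraph G} := Set.Finite.measurableSet (Set.toFinite _)
  -- Only the constancy of the mass on cluster graphs is needed; total mass one then forces its
  -- value.
  obtain ⟨κ, hκ⟩ : ∃ κ : ℝ, ∀ G : SimpleGraph (Fin n),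
      (randomClusterGraph n criticalProb).real {G} = if IsClusterGraph G then κ else 0 := by
    refine ⟨((SimpleGraph.binomialRandom (Fin n) criticalProb {G | IsClusterGraph G})⁻¹ *
      (unitInterval.toNNReal criticalProb : ENNReal) ^ (n.choose 2)).toReal, fun G => ?_⟩
    rw [measureReal_def, randomClusterGraph, cond_apply hmeas]
    split_ifs with hG
    · rw [Set.inter_eq_right.mpr (Set.singleton_subset_iff.mpr hG),
        binomialRandom_criticalProb_singleton]
    · rw [Set.inter_singleton_eq_empty.mpr hG]
      simp
  have h1 : ∑ G : SimpleGraph (Fin n), (randomClusterGraph n criticalProb).real {G} = 1 := by simp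
  simp_rw [hκ] at h1
  rw [← Finset.sum_filter, Finset.sum_const, nsmul_eq_mul] at h1
  rw [hκ, eq_inv_of_mul_eq_one_right h1]
  rfl

open Classical in
theorem integral_clusterGraphWithVertex {𝕜 : Type*} [RCLike 𝕜] (n : ℕ) [NeZero n]
    (F : SimpleGraph (Fin n) × Fin n → 𝕜) :
    ∫ x, F x ∂(clusterGraphWithVertex n criticalProb) =
      ((clusterCount n : 𝕜))⁻¹ * (n : 𝕜)⁻¹ * ∑ G with IsClusterGraph G, ∑ v, F (G, v) := by
  have h1 : ∀ (G : SimpleGraph (Fin n)) (v : Fin n),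
      (clusterGraphWithVertex n criticalProb).real {(G, v)} =
        (if IsClusterGraph G then ((clusterCount n : ℝ))⁻¹ else 0) * (n : ℝ)⁻¹ := by
    intro G v
    rw [clusterGraphWithVertex, ← Set.singleton_prod_singleton, measureReal_prod_prod,
      randomClusterGraph_real_singleton]
    congr 1
    rw [measureReal_def, uniformOn_univ]
    simp
  rw [integral_fintype (Integrable.of_finite), Fintype.sum_prod_type]
  simp_rw [h1, Finset.sum_filter, Finset.mul_sum]
  refine Finset.sum_congr rfl fun G _ => ?_
  split_ifs with hG
  · rw [Finset.mul_sum]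
    refine Finset.sum_congr rfl fun v _ => ?_
    rw [RCLike.real_smul_eq_coe_mul]
    push_cast
    rfl
  · simp

/-! ### Stam's distribution and the mixture representation -/

/-- The unnormalised weights `m ^ n / m!`. -/
def stamWeight (n m : ℕ) : ℝ := (m : ℝ) ^ n / m.factorial

theorem stamWeight_nonneg (n m : ℕ) : 0 ≤ stamWeight n m := by
  unfold stamWeight
  positivity

/-- Dobinski's formula for the constant function 1; `clusterCount n` is the Bell number. -/
theorem hasSum_stamWeight (n : ℕ) :
    HasSum (stamWeight n) (Real.exp 1 * clusterCount n) := by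
  classical
  have h := hasSum_sum_fiberGraph (V := Fin n) (𝕜 := ℝ) (fun _ => 1)
  simp only [Finset.sum_const, nsmul_eq_mul, mul_one] at h
  have hw : ∀ m, stamWeight n m =
      ((m.factorial : ℝ))⁻¹ * (((Finset.univ : Finset (Fin n → Fin m)).card : ℕ) : ℝ) := by
    intro m
    unfold stamWeight
    rw [Finset.card_univ, Fintype.card_fun, Fintype.card_fin, Fintype.card_fin, Nat.cast_pow,
      div_eq_inv_mul]
  rw [funext hw]
  exact h

/-- The sum of the weights `m ^ n / m!`. -/
def stamMass (n : ℕ) : ℝ := Real.exp 1 * clusterCount n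

theorem stamMass_pos (n : ℕ) : 0 < stamMass n :=
  mul_pos (Real.exp_pos _) (by exact_mod_cast clusterCount_pos n)

/-- Stam's distribution: the probability of `m` is proportional to `m ^ n / m!`. -/
def stamPMF (n : ℕ) : PMF ℕ :=
  ⟨fun m => ENNReal.ofReal (stamWeight n m / stamMass n), by
    have h := (hasSum_stamWeight n).div_const (stamMass n)
    rw [ENNReal.summable.hasSum_iff, ← ENNReal.ofReal_tsum_of_nonneg
      (fun m => div_nonneg (stamWeight_nonneg n m) (stamMass_pos n).le) h.summable, h.tsum_eq,
      ← stamMass, div_self (stamMass_pos n).ne', ENNReal.ofReal_one]⟩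

/-- Stam's distribution as a measure. -/
def stamMeasure (n : ℕ) : Measure ℕ := (stamPMF n).toMeasure

instance (n : ℕ) : IsProbabilityMeasure (stamMeasure n) := by
  unfold stamMeasure
  infer_instance

theorem integral_stamMeasure {𝕜 : Type*} [RCLike 𝕜] (n : ℕ) {h : ℕ → 𝕜}
    (hh : Integrable h (stamMeasure n)) :
    ∫ m, h m ∂(stamMeasure n) = (stamMass n : 𝕜)⁻¹ * ∑' m, (stamWeight n m : 𝕜) * h m := by
  rw [stamMeasure, PMF.integral_eq_tsum _ _ hh, ← tsum_mul_left]
  refine tsum_congr fun m => ?_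
  have : ((stamPMF n) m).toReal = stamWeight n m / stamMass n :=
    ENNReal.toReal_ofReal (div_nonneg (stamWeight_nonneg n m) (stamMass_pos n).le)
  rw [this, RCLike.real_smul_eq_coe_mul]
  push_cast
  ring

theorem integrable_stamMeasure_of_bound {𝕜 : Type*} [RCLike 𝕜] (n : ℕ) {h : ℕ → 𝕜} (C : ℝ)
    (hC : ∀ m, ‖h m‖ ≤ C) : Integrable h (stamMeasure n) :=
  Integrable.of_bound (Measurable.of_discrete).aestronglyMeasurable C (ae_of_all _ hC)

open Classical in
/-- The law of the degree of a uniform vertex is a mixture over Stam's distribution. -/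
theorem integral_degree_eq {𝕜 : Type*} [RCLike 𝕜] (n : ℕ) [NeZero n] (g : ℕ → 𝕜) {h : ℕ → 𝕜}
    (hh : Integrable h (stamMeasure n))
    (hgh : ∀ m : ℕ, ∑ f : Fin n → Fin m, ∑ v, g ((fiberGraph f).degree v) =
      (n : 𝕜) * (m : 𝕜) ^ n * h m) :
    ∫ x, g (x.1.degree x.2) ∂(clusterGraphWithVertex n criticalProb) =
      ∫ m, h m ∂(stamMeasure n) := by
  have h1 := hasSum_sum_fiberGraph (V := Fin n) (𝕜 := 𝕜) (fun G => ∑ v, g (G.degree v))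
  have h2 : ∀ m : ℕ, ((m.factorial : 𝕜))⁻¹ * ∑ f : Fin n → Fin m, ∑ v, g ((fiberGraph f).degree v) =
      (n : 𝕜) * ((stamWeight n m : 𝕜) * h m) := by
    intro m
    rw [hgh, stamWeight]
    push_cast
    ring
  replace h1 := h1.congr_fun fun m => (h2 m).symm
  have hn : (n : 𝕜) ≠ 0 := by exact_mod_cast NeZero.ne n
  have hc : (clusterCount n : 𝕜) ≠ 0 := by exact_mod_cast (clusterCount_pos n).ne'
  have he : ((Real.exp 1 : ℝ) : 𝕜) ≠ 0 := by exact_mod_cast (Real.exp_pos 1).ne'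
  rw [integral_clusterGraphWithVertex, integral_stamMeasure n hh]
  have h3 := h1.tsum_eq
  rw [tsum_mul_left] at h3
  have h4 : ∑' m, (stamWeight n m : 𝕜) * h m = (n : 𝕜)⁻¹ * ((Real.exp 1 : 𝕜) *
      ∑ G : SimpleGraph (Fin n) with IsClusterGraph G, ∑ v, g (G.degree v)) := by
    rw [← h3, inv_mul_cancel_left₀ hn]
  rw [h4, stamMass]
  push_cast
  field_simp

theorem norm_natCast_inv_le_one {𝕜 : Type*} [RCLike 𝕜] (m : ℕ) : ‖((m : 𝕜))⁻¹‖ ≤ 1 := by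
  rw [norm_inv, RCLike.norm_natCast]
  rcases Nat.eq_zero_or_pos m with rfl | hm
  · simp
  · exact inv_le_one_of_one_le₀ (by exact_mod_cast hm)

open Classical in
/-- The generating function of the degree of a uniform vertex. -/
theorem integral_pow_degree {𝕜 : Type*} [RCLike 𝕜] (n : ℕ) [NeZero n] (z : 𝕜) :
    ∫ x, z ^ x.1.degree x.2 ∂(clusterGraphWithVertex n criticalProb) =
      ∫ m, (1 + (z - 1) / (m : 𝕜)) ^ (n - 1) ∂(stamMeasure n) := by
  refine integral_degree_eq n (fun d => z ^ d)
    (integrable_stamMeasure_of_bound n ((1 + ‖z - 1‖) ^ (n - 1)) fun m => ?_) fun m => ?_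
  · rw [norm_pow]
    gcongr
    refine (norm_add_le _ _).trans ?_
    rw [norm_one, div_eq_mul_inv, norm_mul]
    gcongr
    exact mul_le_of_le_one_right (norm_nonneg _) (norm_natCast_inv_le_one m)
  · rw [Finset.sum_comm]
    simp_rw [sum_pow_degree_fiberGraph]
    rw [Finset.sum_const, Finset.card_univ, Fintype.card_fin, nsmul_eq_mul]
    -- At `m = 0` the inverse takes its default value 0, which is harmless because `0 ^ n = 0` for
    -- `n ≠ 0`.
    rcases Nat.eq_zero_or_pos m with rfl | hm
    · simp [NeZero.ne n]
    · have hm' : (m : 𝕜) ≠ 0 := by exact_mod_cast hm.ne'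
      obtain ⟨k, rfl⟩ := Nat.exists_eq_add_one.mpr (NeZero.pos n)
      rw [Nat.add_sub_cancel, pow_succ, mul_assoc, mul_comm ((m : 𝕜) ^ k), mul_assoc, ← mul_pow,
        show (m : 𝕜) * (1 + (z - 1) / m) = m - 1 + z by field_simp; ring]

/-! ### The first two factorial moments of the degree -/

open Classical in
theorem sum_degree_fiberGraph {V : Type*} [Fintype V] [DecidableEq V] (m : ℕ) (v : V) :
    ∑ f : V → Fin m, ((fiberGraph f).degree v : ℝ) =
      m * ((Fintype.card V - 1 : ℕ) * (m : ℝ) ^ (Fintype.card V - 1 - 1)) := by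
  -- The generating function identity holds over any commutative ring. Taking `z` to be the
  -- polynomial variable lets it be differentiated formally and evaluated at 1.
  have h := congrArg (fun p => (Polynomial.derivative p).eval 1)
    (sum_pow_degree_fiberGraph m (Polynomial.X : Polynomial ℝ) v)
  simpa [Polynomial.derivative_pow, Polynomial.eval_finsetSum] using h

open Classical in
theorem sum_degree_mul_degree_sub_one_fiberGraph {V : Type*} [Fintype V] [DecidableEq V] (m : ℕ)
    (v : V) :
    ∑ f : V → Fin m, ((fiberGraph f).degree v : ℝ) * ((fiberGraph f).degree v - 1) =
      m * ((Fintype.card V - 1 : ℕ) * ((Fintype.card V - 1 - 1 : ℕ) *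
        (m : ℝ) ^ (Fintype.card V - 1 - 1 - 1))) := by
  have h := congrArg (fun p => (Polynomial.derivative (Polynomial.derivative p)).eval 1)
    (sum_pow_degree_fiberGraph m (Polynomial.X : Polynomial ℝ) v)
  have h2 : ∀ d : ℕ, (d : ℝ) * ((d - 1 : ℕ) : ℝ) = d * (d - 1) := by
    intro d
    cases d <;> simp
  simpa [Polynomial.derivative_pow, Polynomial.eval_finsetSum, h2] using h

open Classical in
theorem integral_degree (n : ℕ) [NeZero n] :
    ∫ x, (x.1.degree x.2 : ℝ) ∂(clusterGraphWithVertex n criticalProb) =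
      ∫ m, ((n - 1 : ℕ) : ℝ) * ((m : ℝ))⁻¹ ∂(stamMeasure n) := by
  refine integral_degree_eq n (fun d => (d : ℝ))
    ((integrable_stamMeasure_of_bound n 1 norm_natCast_inv_le_one).const_mul _) fun m => ?_
  rw [Finset.sum_comm]
  simp_rw [sum_degree_fiberGraph]
  rw [Finset.sum_const, Finset.card_univ, Fintype.card_fin, nsmul_eq_mul]
  rcases Nat.eq_zero_or_pos m with rfl | hm
  · simp
  · have hm' : (m : ℝ) ≠ 0 := by exact_mod_cast hm.ne'
    -- Small `n` is separated because the natural exponent `n - 1 - 1` truncates; there the factor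
    -- `n - 1` is zero.
    match n, NeZero.ne n with
    | 1, _ => simp
    | k + 2, _ =>
      simp only [Nat.add_sub_cancel, show k + 2 - 1 = k + 1 from rfl]
      field_simp
      ring

open Classical in
theorem integral_degree_mul_degree_sub_one (n : ℕ) [NeZero n] :
    ∫ x, (x.1.degree x.2 : ℝ) * (x.1.degree x.2 - 1) ∂(clusterGraphWithVertex n criticalProb) =
      ∫ m, ((n - 1 : ℕ) : ℝ) * ((n - 1 - 1 : ℕ) : ℝ) * (((m : ℝ))⁻¹) ^ 2 ∂(stamMeasure n) := by
  have hb : Integrable (fun m : ℕ => (((m : ℝ))⁻¹) ^ 2) (stamMeasure n) :=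
    integrable_stamMeasure_of_bound n 1 fun m => by
      rw [norm_pow]
      exact pow_le_one₀ (norm_nonneg _) (norm_natCast_inv_le_one m)
  refine integral_degree_eq n (fun d => (d : ℝ) * ((d : ℝ) - 1)) (hb.const_mul _) fun m => ?_
  rw [Finset.sum_comm]
  simp_rw [sum_degree_mul_degree_sub_one_fiberGraph]
  rw [Finset.sum_const, Finset.card_univ, Fintype.card_fin, nsmul_eq_mul]
  rcases Nat.eq_zero_or_pos m with rfl | hm
  · simp
  · have hm' : (m : ℝ) ≠ 0 := by exact_mod_cast hm.ne'
    match n, NeZero.ne n with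
    | 1, _ => simp
    | 2, _ => simp
    | k + 3, _ =>
      simp only [Nat.add_sub_cancel, show k + 3 - 1 = k + 2 from rfl, show k + 2 - 1 = k + 1 from rfl]
      field_simp
      ring

/-! ### Concentration of Stam's distribution -/

set_option maxHeartbeats 400000 in
/-- The pointwise drift inequality behind the concentration of Stam's distribution. Here
`x = n / m`, `y = n / (m + 1)` and `R` is the ratio of consecutive weights. -/
theorem drift_lower_bound {w n x y R : ℝ} (hw : 4 ≤ w) (hn : w * Real.exp w = n) (hy : 0 < y)
    (hyn : y ≤ n / 2) (hxy : x - y = x * y / n) (hx2 : x ≤ 2 * y) (hyx : y ≤ x)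
    (hR1 : Real.exp y * y / n ≤ R) (hR2 : R ≤ Real.exp x * y / n) :
    (x - w) ^ 2 / w - 10 * w ^ 3 / n ≤ R * (y - w) - (x - w) := by
  have hw0 : 0 < w := by linarith
  have hexp : 1 + w + w ^ 2 / 2 ≤ Real.exp w := by
    have := Real.quadratic_le_exp_of_nonneg hw0.le
    linarith
  have hn0 : 0 < n := by rw [← hn]; positivity
  -- Here `52 = 4 * (1 + 4 + 4 ^ 2 / 2)`, the quadratic lower bound for `4 * exp 4`.
  have hn52 : 52 ≤ n := by rw [← hn]; nlinarith
  have hnw : 2 * w ^ 2 ≤ n := by rw [← hn]; nlinarith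
  have hexpw : Real.exp w = n / w := by rw [← hn]; field_simp
  have hR0 : 0 ≤ R := le_trans (by positivity) hR1
  have hd : x - y ≤ 2 * y ^ 2 / n := by
    rw [hxy]
    refine div_le_div_of_nonneg_right ?_ hn0.le
    nlinarith
  have hd0 : 0 ≤ x - y := by linarith
  have hw32 : 4 * (w ^ 2 / n) ≤ w ^ 3 / n := by
    rw [← mul_div_assoc]
    gcongr
    nlinarith [sq_nonneg w]
  have hwn0 : 0 ≤ w ^ 2 / n := by positivity
  -- Since `exp w = n / w`, the bounds on `R` compare it with `exp (y - w) * (y / w)` and `exp (x -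
  -- w) * (y / w)`: the ratio of weights crosses 1 near `x = w`.
  have hR1' : Real.exp (y - w) * (y / w) ≤ R := by
    refine le_trans (le_of_eq ?_) hR1
    rw [Real.exp_sub, hexpw]
    field_simp
  have hR2' : R ≤ Real.exp (x - w) * (y / w) := by
    refine hR2.trans (le_of_eq ?_)
    rw [Real.exp_sub, hexpw]
    field_simp
  -- If `w ≤ y`, the exponential supplies the quadratic gain. If `x ≤ w`, the factor `y / w` alone
  -- supplies it. If `y < w < x`, every term is controlled by the small gap `x - y`.
  rcases le_or_gt w y with hwy | hwy
  · obtain ⟨u, rfl⟩ : ∃ u, y = w + u := ⟨y - w, by ring⟩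
    have hu : 0 ≤ u := by linarith
    -- The cubic term of `R * u` is kept because it must absorb the `u ^ 3` part of `(x - y) ^ 2`,
    -- as `u` is not bounded.
    have hR3 : 1 + u + u ^ 2 / 2 ≤ R := by
      refine le_trans ?_ hR1'
      rw [add_sub_cancel_left]
      have h1 := Real.quadratic_le_exp_of_nonneg hu
      have h2 : 1 ≤ (w + u) / w := by rw [le_div_iff₀ hw0]; linarith
      nlinarith
    have hmain : u + u ^ 2 + u ^ 3 / 2 ≤ R * u := by
      have := mul_le_mul_of_nonneg_right hR3 hu
      linarith
    have hd1 : x - (w + u) ≤ u ^ 2 / 13 + 4 * (w ^ 2 / n) := by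
      refine hd.trans ?_
      have h1 : 2 * (w + u) ^ 2 / n ≤ (4 * u ^ 2 + 4 * w ^ 2) / n := by
        gcongr
        nlinarith [sq_nonneg (w - u)]
      have h2 : 4 * u ^ 2 / n ≤ u ^ 2 / 13 := by
        rw [div_le_div_iff₀ hn0 (by norm_num)]
        nlinarith [sq_nonneg u]
      rw [add_div] at h1
      have h3 : 4 * (w ^ 2 / n) = 4 * w ^ 2 / n := by ring
      linarith
    have hd2 : (x - (w + u)) ^ 2 ≤ u ^ 3 * (2 / 13) + 8 * (w ^ 3 / n) := by
      have h0 : (x - (w + u)) ^ 2 ≤ (2 * (w + u) ^ 2 / n) ^ 2 := by gcongr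
      have h1 : (2 * (w + u) ^ 2 / n) ^ 2 ≤ 2 * (w + u) ^ 3 / n := by
        have : (2 * (w + u) ^ 2 / n) ^ 2 = 2 * (w + u) ^ 3 / n * (2 * (w + u) / n) := by ring
        rw [this]
        refine mul_le_of_le_one_right (by positivity) ?_
        rw [div_le_one hn0]
        linarith
      have h2 : 2 * (w + u) ^ 3 / n ≤ (8 * u ^ 3 + 8 * w ^ 3) / n := by
        have := add_pow_le hw0.le hu 3
        norm_num at this
        gcongr
        linarith
      have h3 : 8 * u ^ 3 / n ≤ u ^ 3 * (2 / 13) := by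
        rw [div_le_iff₀ hn0]
        have := mul_le_mul_of_nonneg_left hn52 (pow_nonneg hu 3)
        linarith
      rw [add_div] at h2
      have h4 : 8 * (w ^ 3 / n) = 8 * w ^ 3 / n := by ring
      linarith
    have hsq : (x - w) ^ 2 ≤ 2 * u ^ 2 + 2 * (x - (w + u)) ^ 2 := by
      linarith [sq_nonneg (x - (w + u) - u)]
    have hsqw : (x - w) ^ 2 / w ≤ (x - w) ^ 2 / 4 := by gcongr
    have h10 : 10 * w ^ 3 / n = 10 * (w ^ 3 / n) := by ring
    rw [h10, add_sub_cancel_left]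
    have := sq_nonneg u
    have := pow_nonneg hu 3
    linarith
  · have hd1 : x - y ≤ 2 * (w ^ 2 / n) := by
      refine hd.trans ?_
      rw [← mul_div_assoc]
      gcongr
    have h10 : 10 * w ^ 3 / n = 10 * (w ^ 3 / n) := by ring
    rw [h10]
    rcases le_or_gt x w with hxw | hxw
    · have hR3 : R ≤ y / w := by
        refine hR2'.trans (mul_le_of_le_one_left (by positivity) ?_)
        exact Real.exp_le_one_iff.mpr (by linarith)
      have h1 : (y / w) * (y - w) ≤ R * (y - w) := mul_le_mul_of_nonpos_right hR3 (by linarith)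
      have h2 : (x - w) ^ 2 / w ≤ (y - w) ^ 2 / w := by
        gcongr ?_ / w
        nlinarith
      have h3 : (y - w) ^ 2 / w = (y / w) * (y - w) - (y - w) := by
        field_simp
      linarith
    · have h1 : 2 * (w ^ 2 / n) ≤ 1 := by
        rw [← mul_div_assoc, div_le_one hn0]
        exact hnw
      have hR3 : R ≤ 3 := by
        have h2 : Real.exp (x - w) ≤ Real.exp 1 := Real.exp_le_exp.mpr (by linarith)
        have h3 : y / w ≤ 1 := by rw [div_le_one hw0]; exact hwy.le
        have h4 := Real.exp_one_lt_d9
        have h5 : Real.exp (x - w) * (y / w) ≤ Real.exp (x - w) :=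
          mul_le_of_le_one_right (Real.exp_pos _).le h3
        linarith
      have h2 : (x - w) ^ 2 / w ≤ x - y := by
        rw [div_le_iff₀ hw0]
        nlinarith
      nlinarith

/-- From `1 - t ≤ exp (-t)` at `t = 1 / (m + 1)`, whose left side is the inverse of `1 + 1 / m`. -/
theorem exp_le_one_add_inv_pow (n : ℕ) {m : ℝ} (hm : 0 < m) :
    Real.exp (n / (m + 1)) ≤ (1 + 1 / m) ^ n := by
  have h1 : Real.exp (1 / (m + 1)) ≤ 1 + 1 / m := by
    have h := Real.add_one_le_exp (-(1 / (m + 1)))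
    rw [Real.exp_neg, show -(1 / (m + 1)) + 1 = (1 + 1 / m)⁻¹ by field_simp; ring] at h
    exact (inv_le_inv₀ (by positivity) (Real.exp_pos _)).mp h
  rw [show (n : ℝ) / (m + 1) = n * (1 / (m + 1)) by ring, Real.exp_nat_mul]
  gcongr

theorem one_add_inv_pow_le_exp (n : ℕ) {m : ℝ} (hm : 0 < m) :
    (1 + 1 / m) ^ n ≤ Real.exp (n / m) := by
  rw [show (n : ℝ) / m = n * (1 / m) by ring, Real.exp_nat_mul]
  gcongr
  linarith [Real.add_one_le_exp (1 / m)]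

theorem stamWeight_succ (n m : ℕ) (hm : 0 < m) :
    stamWeight n (m + 1) = stamWeight n m * ((1 + 1 / (m : ℝ)) ^ n / (m + 1)) := by
  have hm' : (m : ℝ) ≠ 0 := by exact_mod_cast hm.ne'
  have h : (1 + 1 / (m : ℝ)) = (m + 1) / m := by field_simp
  rw [stamWeight, stamWeight, h, div_pow, Nat.factorial_succ]
  have hf : (m.factorial : ℝ) ≠ 0 := by positivity
  push_cast
  field_simp

theorem stamWeight_zero_right (n : ℕ) [NeZero n] : stamWeight n 0 = 0 := by
  simp [stamWeight, NeZero.ne n]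

/-- The form of `drift_lower_bound` that can be summed: the right side is a difference of
consecutive terms. -/
theorem stamWeight_mul_drift_le (n : ℕ) [NeZero n] {w : ℝ} (hw : 4 ≤ w)
    (hn : w * Real.exp w = n) (m : ℕ) :
    stamWeight n m * ((n / (m : ℝ) - w) ^ 2 / w - 10 * w ^ 3 / n) ≤
      stamWeight n (m + 1) * (n / ((m + 1 : ℕ) : ℝ) - w) - stamWeight n m * (n / (m : ℝ) - w) := by
  have hn0 : (0 : ℝ) < n := by exact_mod_cast NeZero.pos n
  -- At `m = 0` the weight vanishes, and what remains is `w ≤ n`.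
  rcases Nat.eq_zero_or_pos m with rfl | hm
  · have hwn : w ≤ n := by
      rw [← hn]
      nlinarith [Real.one_le_exp (show 0 ≤ w by linarith)]
    simp [stamWeight, NeZero.ne n, hwn]
  · have hm1 : (1 : ℝ) ≤ m := by exact_mod_cast hm
    have hm0 : (0 : ℝ) < m := by linarith
    rw [stamWeight_succ n m hm, mul_assoc, ← mul_sub]
    refine mul_le_mul_of_nonneg_left ?_ (stamWeight_nonneg n m)
    push_cast
    have hyn : (n : ℝ) / (m + 1) / n = 1 / (m + 1) := by field_simp
    apply drift_lower_bound hw hn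
    · positivity
    · gcongr
      linarith
    · field_simp
      ring
    · rw [div_le_iff₀ hm0]
      field_simp
      linarith
    · gcongr
      linarith
    · rw [mul_div_assoc, hyn, mul_one_div]
      gcongr
      exact exp_le_one_add_inv_pow n hm0
    · rw [mul_div_assoc, hyn, mul_one_div]
      gcongr
      exact one_add_inv_pow_le_exp n hm0

theorem norm_natCast_div_le (n m : ℕ) : ‖(n : ℝ) / m‖ ≤ n := by
  rw [div_eq_mul_inv, norm_mul, RCLike.norm_natCast]
  exact mul_le_of_le_one_right (Nat.cast_nonneg n) (norm_natCast_inv_le_one m)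

/-- Under Stam's distribution `n / m` is concentrated near `W(n)`. -/
theorem integral_sq_sub_le (n : ℕ) [NeZero n] {w : ℝ} (hw : 4 ≤ w) (hn : w * Real.exp w = n) :
    ∫ m : ℕ, ((n : ℝ) / m - w) ^ 2 ∂(stamMeasure n) ≤ 10 * w ^ 4 / n := by
  have hw0 : 0 < w := by linarith
  have hs : Summable (stamWeight n) := (hasSum_stamWeight n).summable
  have hbd : ∀ m : ℕ, ‖(n : ℝ) / m - w‖ ≤ n + w := fun m =>
    (norm_sub_le _ _).trans (add_le_add (norm_natCast_div_le n m) (by simp [abs_of_pos hw0]))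
  have hbd2 : ∀ m : ℕ, ‖((n : ℝ) / m - w) ^ 2‖ ≤ (n + w) ^ 2 := fun m => by
    rw [norm_pow]
    exact pow_le_pow_left₀ (norm_nonneg _) (hbd m) 2
  have hsum : ∀ (h : ℕ → ℝ) (C : ℝ), (∀ m, ‖h m‖ ≤ C) →
      Summable fun m => stamWeight n m * h m := fun h C hC =>
    Summable.of_norm_bounded (hs.mul_right C) fun m => by
      rw [norm_mul, Real.norm_of_nonneg (stamWeight_nonneg n m)]
      exact mul_le_mul_of_nonneg_left (hC m) (stamWeight_nonneg n m)
  have hbc : ∀ m : ℕ, ‖((n : ℝ) / m - w) ^ 2 / w - 10 * w ^ 3 / n‖ ≤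
      (n + w) ^ 2 / w + ‖10 * w ^ 3 / (n : ℝ)‖ := fun m => by
    refine (norm_sub_le _ _).trans (add_le_add ?_ le_rfl)
    rw [norm_div, Real.norm_of_nonneg hw0.le]
    exact div_le_div_of_nonneg_right (hbd2 m) hw0.le
  -- The shifted and the unshifted series differ by the term at `m = 0`, which is zero, so the right
  -- sides of the drift inequality sum to zero.
  have hb := (hsum _ _ hbd).hasSum
  have hb1 := (hasSum_nat_add_iff' 1).mpr hb
  have hdiff := hb1.sub hb
  have hle := hasSum_le (stamWeight_mul_drift_le n hw hn) (hsum _ _ hbc).hasSum hdiff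
  have hint := integral_stamMeasure n (integrable_stamMeasure_of_bound n _ hbc)
  have hi2 := integrable_stamMeasure_of_bound n _ hbd2
  rw [integral_sub (hi2.div_const w) (integrable_const _), integral_div, integral_const] at hint
  simp only [Finset.range_one, Finset.sum_singleton, stamWeight_zero_right, zero_mul, sub_zero,
    sub_self] at hle
  have hneg : (stamMass n)⁻¹ * ∑' m : ℕ, stamWeight n m *
      (((n : ℝ) / m - w) ^ 2 / w - 10 * w ^ 3 / n) ≤ 0 :=
    mul_nonpos_of_nonneg_of_nonpos (inv_nonneg.mpr (stamMass_pos n).le) hle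
  have h0 : (∫ m : ℕ, ((n : ℝ) / m - w) ^ 2 ∂(stamMeasure n)) / w - 10 * w ^ 3 / n ≤ 0 := by
    refine le_trans (le_of_eq ?_) hneg
    simpa using hint
  have h1 : (∫ m : ℕ, ((n : ℝ) / m - w) ^ 2 ∂(stamMeasure n)) ≤ 10 * w ^ 3 / n * w := by
    rw [← div_le_iff₀ hw0]
    linarith
  refine h1.trans (le_of_eq ?_)
  ring

/-! ### Mean and variance of the degree at fixed `n` -/

theorem sq_integral_le_integral_sq {Ω : Type*} [MeasurableSpace Ω] {μ : Measure Ω}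
    [IsProbabilityMeasure μ] {f : Ω → ℝ} (hf : MemLp f 2 μ) :
    (∫ x, f x ∂μ) ^ 2 ≤ ∫ x, f x ^ 2 ∂μ := by
  have h := variance_nonneg f μ
  rw [variance_eq_sub hf] at h
  simpa using h

theorem integral_abs_sub_sq_le (n : ℕ) (w : ℝ) :
    (∫ m : ℕ, |(n : ℝ) / m - w| ∂(stamMeasure n)) ^ 2 ≤
      ∫ m : ℕ, ((n : ℝ) / m - w) ^ 2 ∂(stamMeasure n) := by
  have h := sq_integral_le_integral_sq (μ := stamMeasure n) (f := fun m : ℕ => |(n : ℝ) / m - w|)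
    (MemLp.of_bound (Measurable.of_discrete).aestronglyMeasurable (n + |w|) (ae_of_all _ fun m => by
      rw [Real.norm_eq_abs, abs_abs]
      exact (abs_sub _ _).trans (add_le_add (norm_natCast_div_le n m) le_rfl)))
  simpa using h

theorem degreeMean_eq (n : ℕ) [NeZero n] :
    degreeMean n criticalProb =
      (n - 1) / n * ∫ m : ℕ, (n : ℝ) / m ∂(stamMeasure n) := by
  have hn : (n : ℝ) ≠ 0 := by exact_mod_cast NeZero.ne n
  have h1 : degreeMean n criticalProb = _ := integral_degree n
  rw [h1, ← integral_const_mul]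
  refine integral_congr_ae (ae_of_all _ fun m => ?_)
  simp only
  rw [Nat.cast_sub (NeZero.pos n), Nat.cast_one]
  field_simp

theorem memLp_vertexDegree (n : ℕ) [NeZero n] :
    MemLp (vertexDegree n) 2 (clusterGraphWithVertex n criticalProb) :=
  MemLp.of_bound (measurable_vertexDegree n).aestronglyMeasurable n (ae_of_all _ fun x => by
    classical
    rw [vertexDegree, Real.norm_of_nonneg (Nat.cast_nonneg _)]
    have := x.1.degree_lt_card_verts x.2
    rw [Fintype.card_fin] at this
    exact_mod_cast this.le)

theorem degreeVar_eq (n : ℕ) (hn2 : 2 ≤ n) [NeZero n] :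
    degreeVar n criticalProb =
      (n - 1) * (n - 2) / n ^ 2 * (∫ m : ℕ, ((n : ℝ) / m) ^ 2 ∂(stamMeasure n)) +
        degreeMean n criticalProb - degreeMean n criticalProb ^ 2 := by
  have hn : (n : ℝ) ≠ 0 := by exact_mod_cast NeZero.ne n
  have h1 : ∫ x, vertexDegree n x * (vertexDegree n x - 1)
      ∂(clusterGraphWithVertex n criticalProb) = _ := integral_degree_mul_degree_sub_one n
  have h2 : ∫ m : ℕ, ((n - 1 : ℕ) : ℝ) * ((n - 1 - 1 : ℕ) : ℝ) * (((m : ℝ))⁻¹) ^ 2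
      ∂(stamMeasure n) =
      (n - 1) * (n - 2) / n ^ 2 * (∫ m : ℕ, ((n : ℝ) / m) ^ 2 ∂(stamMeasure n)) := by
    rw [← integral_const_mul]
    refine integral_congr_ae (ae_of_all _ fun m => ?_)
    simp only
    rw [Nat.sub_sub, Nat.cast_sub (NeZero.pos n), Nat.cast_sub hn2]
    push_cast
    field_simp
  have hm := memLp_vertexDegree n
  rw [degreeVar, variance_eq_sub hm, ← h2, ← h1]
  have h3 : ∫ x, vertexDegree n x * (vertexDegree n x - 1)
      ∂(clusterGraphWithVertex n criticalProb) =
      (∫ x, (vertexDegree n ^ 2) x ∂(clusterGraphWithVertex n criticalProb)) -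
        degreeMean n criticalProb := by
    have hi : Integrable (fun x => (vertexDegree n ^ 2) x)
        (clusterGraphWithVertex n criticalProb) := hm.integrable_sq
    rw [degreeMean, ← integral_sub hi (hm.integrable one_le_two)]
    refine integral_congr_ae (ae_of_all _ fun x => ?_)
    simp only [Pi.pow_apply]
    ring
  rw [h3, degreeMean]
  ring

theorem integrable_natCast_div (n : ℕ) : Integrable (fun m : ℕ => (n : ℝ) / m) (stamMeasure n) :=
  integrable_stamMeasure_of_bound n n (norm_natCast_div_le n)

theorem integrable_natCast_div_sq (n : ℕ) :
    Integrable (fun m : ℕ => ((n : ℝ) / m) ^ 2) (stamMeasure n) :=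
  integrable_stamMeasure_of_bound n (n ^ 2) fun m => by
    rw [norm_pow]
    exact pow_le_pow_left₀ (norm_nonneg _) (norm_natCast_div_le n m) 2

theorem integral_sq_sub_eq (n : ℕ) (w : ℝ) :
    ∫ m : ℕ, ((n : ℝ) / m - w) ^ 2 ∂(stamMeasure n) =
      (∫ m : ℕ, ((n : ℝ) / m) ^ 2 ∂(stamMeasure n)) -
        2 * w * (∫ m : ℕ, (n : ℝ) / m ∂(stamMeasure n)) + w ^ 2 := by
  have h : ∀ m : ℕ, ((n : ℝ) / m - w) ^ 2 = ((n : ℝ) / m) ^ 2 - 2 * w * ((n : ℝ) / m) + w ^ 2 :=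
    fun m => by ring
  simp_rw [h]
  have hi : Integrable (fun m : ℕ => ((n : ℝ) / m) ^ 2 - 2 * w * ((n : ℝ) / m)) (stamMeasure n) :=
    (integrable_natCast_div_sq n).sub ((integrable_natCast_div n).const_mul _)
  rw [integral_add hi (integrable_const _), integral_sub (integrable_natCast_div_sq n)
    ((integrable_natCast_div n).const_mul _), integral_const_mul]
  simp

theorem abs_integral_natCast_div_sub_le (n : ℕ) (w : ℝ) :
    |(∫ m : ℕ, (n : ℝ) / m ∂(stamMeasure n)) - w| ≤
      ∫ m : ℕ, |(n : ℝ) / m - w| ∂(stamMeasure n) := by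
  have h : (∫ m : ℕ, (n : ℝ) / m ∂(stamMeasure n)) - w =
      ∫ m : ℕ, ((n : ℝ) / m - w) ∂(stamMeasure n) := by
    rw [integral_sub (integrable_natCast_div n) (integrable_const _)]
    simp
  rw [h]
  exact abs_integral_le_integral_abs

theorem abs_degreeMean_sub_le (n : ℕ) [NeZero n] {w A : ℝ}
    (hA : ∫ m : ℕ, |(n : ℝ) / m - w| ∂(stamMeasure n) ≤ A) :
    |degreeMean n criticalProb - w| ≤ A + (w + A) / n := by
  have hn : (0 : ℝ) < n := by exact_mod_cast NeZero.pos n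
  have h1 := (abs_integral_natCast_div_sub_le n w).trans hA
  have h0 : 0 ≤ ∫ m : ℕ, (n : ℝ) / m ∂(stamMeasure n) := integral_nonneg fun m => by positivity
  rw [degreeMean_eq]
  set q := ∫ m : ℕ, (n : ℝ) / m ∂(stamMeasure n)
  have h2 : (n - 1) / (n : ℝ) * q - w = (q - w) - q / n := by
    field_simp
    ring
  rw [h2]
  refine (abs_sub _ _).trans (add_le_add h1 ?_)
  rw [abs_of_nonneg (by positivity)]
  gcongr
  linarith [(abs_le.mp h1).2]

/-- A mixture of Poisson laws has variance minus mean equal to the variance of the parameter, here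
at most the mean square of `n / m - w`. The term divided by `n` corrects for the components being
binomial. -/
theorem abs_degreeVar_sub_degreeMean_le (n : ℕ) (hn2 : 2 ≤ n) [NeZero n] (w : ℝ) :
    |degreeVar n criticalProb - degreeMean n criticalProb| ≤
      (∫ m : ℕ, ((n : ℝ) / m - w) ^ 2 ∂(stamMeasure n)) +
        (∫ m : ℕ, ((n : ℝ) / m) ^ 2 ∂(stamMeasure n)) / n := by
  have hn : (2 : ℝ) ≤ n := by exact_mod_cast hn2
  have hV := integral_sq_sub_eq n w
  have hq := sq_integral_le_integral_sq (μ := stamMeasure n) (f := fun m : ℕ => (n : ℝ) / m)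
    (MemLp.of_bound (Measurable.of_discrete).aestronglyMeasurable n
      (ae_of_all _ (norm_natCast_div_le n)))
  rw [degreeVar_eq n hn2, degreeMean_eq, hV]
  set q := ∫ m : ℕ, (n : ℝ) / m ∂(stamMeasure n)
  set Q := ∫ m : ℕ, ((n : ℝ) / m) ^ 2 ∂(stamMeasure n)
  have hQ0 : 0 ≤ Q := (sq_nonneg q).trans hq
  have h1 : (n - 1) * (n - 2) / (n : ℝ) ^ 2 * Q + (n - 1) / n * q - ((n - 1) / n * q) ^ 2 -
      (n - 1) / n * q = ((n - 1) / n) ^ 2 * (Q - q ^ 2) - (n - 1) / n * (Q / n) := by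
    field_simp
    ring
  have hr0 : 0 ≤ (n - 1) / (n : ℝ) := div_nonneg (by linarith) (by linarith)
  have hr1 : (n - 1) / (n : ℝ) ≤ 1 := by rw [div_le_one (by linarith)]; linarith
  have h2 : ((n - 1) / (n : ℝ)) ^ 2 * (Q - q ^ 2) ≤ Q - q ^ 2 :=
    mul_le_of_le_one_left (by linarith) (pow_le_one₀ hr0 hr1)
  have h3 : 0 ≤ ((n - 1) / (n : ℝ)) ^ 2 * (Q - q ^ 2) := mul_nonneg (by positivity) (by linarith)
  have hQn : 0 ≤ Q / n := by positivity
  have h4 : (n - 1) / (n : ℝ) * (Q / n) ≤ Q / n := mul_le_of_le_one_left hQn hr1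
  have h5 : 0 ≤ (n - 1) / (n : ℝ) * (Q / n) := mul_nonneg hr0 hQn
  rw [h1, abs_le]
  -- The nonnegative `(q - w) ^ 2` is the excess of the second moment about `w` over the variance `Q
  -- - q ^ 2`.
  constructor <;> nlinarith [sq_nonneg (q - w)]

/-! ### Poisson approximation of the characteristic function -/

/-- The mean value inequality on the left half-plane, which is convex and where the derivative of
`exp` has norm at most 1. -/
theorem norm_exp_sub_exp_le {a b : ℂ} (ha : a.re ≤ 0) (hb : b.re ≤ 0) :
    ‖Complex.exp a - Complex.exp b‖ ≤ ‖a - b‖ := by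
  have h := Convex.norm_image_sub_le_of_norm_hasDerivWithin_le (f := Complex.exp)
    (f' := Complex.exp) (s := {z : ℂ | z.re ≤ 0}) (C := 1) (x := b) (y := a)
    (fun z _ => (Complex.hasDerivAt_exp z).hasDerivWithinAt)
    (fun z hz => by rw [Complex.norm_exp]; exact Real.exp_le_one_iff.mpr hz)
    (convex_halfSpace_re_le 0) hb ha
  simpa using h

theorem norm_pow_sub_pow_le {a b : ℂ} (ha : ‖a‖ ≤ 1) (hb : ‖b‖ ≤ 1) (k : ℕ) :
    ‖a ^ k - b ^ k‖ ≤ k * ‖a - b‖ := by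
  induction k with
  | zero => simp
  | succ k ih =>
    have h : a ^ (k + 1) - b ^ (k + 1) = a * (a ^ k - b ^ k) + (a - b) * b ^ k := by ring
    rw [h]
    refine (norm_add_le _ _).trans ?_
    rw [norm_mul, norm_mul, norm_pow]
    have h1 : ‖a‖ * ‖a ^ k - b ^ k‖ ≤ k * ‖a - b‖ :=
      (mul_le_of_le_one_left (norm_nonneg _) ha).trans ih
    have h2 : ‖a - b‖ * ‖b‖ ^ k ≤ ‖a - b‖ :=
      mul_le_of_le_one_right (norm_nonneg _) (pow_le_one₀ (norm_nonneg _) hb)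
    push_cast
    linarith

/-- Poisson approximation of the generating function of a binomial distribution. -/
theorem norm_binomial_sub_poisson_le (n m : ℕ) [NeZero n] {s w : ℝ} (hs : |s| ≤ 1) (hw : 0 ≤ w) :
    ‖(1 + (Complex.exp (s * Complex.I) - 1) / (m : ℂ)) ^ (n - 1) -
        Complex.exp ((Complex.exp (s * Complex.I) - 1) * w)‖ ≤
      s ^ 2 * (((n : ℝ) / m) ^ 2 / n) + |s| * (|(n : ℝ) / m - w| + (n : ℝ) / m / n) := by
  have hn0 : (n : ℝ) ≠ 0 := by exact_mod_cast NeZero.ne n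
  set z := Complex.exp (s * Complex.I) with hz
  have hz1 : ‖z‖ = 1 := Complex.norm_exp_ofReal_mul_I s
  have hzs : ‖z - 1‖ ≤ |s| := by
    have := Real.norm_exp_I_mul_ofReal_sub_one_le (x := s)
    rwa [mul_comm, Real.norm_eq_abs] at this
  have hre : (z - 1).re ≤ 0 := by
    have := Complex.re_le_norm z
    rw [Complex.sub_re, Complex.one_re]
    linarith
  have hreal : ∀ r : ℝ, 0 ≤ r → ((z - 1) * (r : ℂ)).re ≤ 0 := fun r hr => by
    rw [Complex.re_mul_ofReal]
    exact mul_nonpos_of_nonpos_of_nonneg hre hr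
  have hinv : (z - 1) / (m : ℂ) = (z - 1) * (((m : ℝ)⁻¹ : ℝ) : ℂ) := by
    push_cast
    rw [div_eq_mul_inv]
  have hm1 : ((m : ℝ))⁻¹ ≤ 1 := by
    have := norm_natCast_inv_le_one (𝕜 := ℝ) m
    exact (le_abs_self _).trans this
  have hm0 : 0 ≤ ((m : ℝ))⁻¹ := by positivity
  have hnorm : ‖1 + (z - 1) / (m : ℂ)‖ ≤ 1 := by
    -- A convex combination of 1 and `z`, including at `m = 0`, where the inverse is 0.
    have : 1 + (z - 1) / (m : ℂ) = ((1 - (m : ℝ)⁻¹ : ℝ) : ℂ) + z * (((m : ℝ)⁻¹ : ℝ) : ℂ) := by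
      rw [hinv]
      push_cast
      ring
    rw [this]
    refine (norm_add_le _ _).trans ?_
    rw [norm_mul, hz1, Complex.norm_real, Complex.norm_real, Real.norm_of_nonneg hm0,
      Real.norm_of_nonneg (by linarith)]
    linarith
  have hnd : ‖(z - 1) / (m : ℂ)‖ ≤ |s| * ((m : ℝ))⁻¹ := by
    rw [hinv, norm_mul, Complex.norm_real, Real.norm_of_nonneg hm0]
    gcongr
  have hnd1 : ‖(z - 1) / (m : ℂ)‖ ≤ 1 := hnd.trans (mul_le_one₀ hs hm0 hm1)
  have hk : ((n - 1 : ℕ) : ℝ) = n - 1 := by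
    rw [Nat.cast_sub (NeZero.pos n), Nat.cast_one]
  have hk0 : (0 : ℝ) ≤ (n - 1 : ℕ) := Nat.cast_nonneg _
  -- First each factor `1 + ζ` is replaced by `exp ζ`, at a cost of at most `‖ζ‖ ^ 2` per factor;
  -- then `hstep2` replaces the Poisson mean `(n - 1) / m` by `w`.
  have hstep1 : ‖(1 + (z - 1) / (m : ℂ)) ^ (n - 1) -
      Complex.exp ((z - 1) / (m : ℂ)) ^ (n - 1)‖ ≤ s ^ 2 * (((n : ℝ) / m) ^ 2 / n) := by
    refine (norm_pow_sub_pow_le hnorm ?_ _).trans ?_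
    · rw [Complex.norm_exp, hinv]
      exact Real.exp_le_one_iff.mpr (hreal _ hm0)
    · have h1 : ‖1 + (z - 1) / (m : ℂ) - Complex.exp ((z - 1) / (m : ℂ))‖ ≤
          (|s| * ((m : ℝ))⁻¹) ^ 2 := by
        rw [norm_sub_rev, ← sub_sub]
        exact (Complex.norm_exp_sub_one_sub_id_le hnd1).trans (by gcongr)
      calc ((n - 1 : ℕ) : ℝ) * ‖1 + (z - 1) / (m : ℂ) - Complex.exp ((z - 1) / (m : ℂ))‖
          ≤ n * (|s| * ((m : ℝ))⁻¹) ^ 2 := by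
            gcongr
            exact n.sub_le 1
        _ = s ^ 2 * (((n : ℝ) / m) ^ 2 / n) := by
            rw [mul_pow, sq_abs]
            field_simp
  have hstep2 : ‖Complex.exp ((z - 1) / (m : ℂ)) ^ (n - 1) - Complex.exp ((z - 1) * w)‖ ≤
      |s| * (|(n : ℝ) / m - w| + (n : ℝ) / m / n) := by
    have he : Complex.exp ((z - 1) / (m : ℂ)) ^ (n - 1) =
        Complex.exp ((z - 1) * ((((n - 1 : ℕ) : ℝ) * (m : ℝ)⁻¹ : ℝ) : ℂ)) := by
      rw [← Complex.exp_nat_mul, hinv]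
      congr 1
      push_cast
      ring
    rw [he]
    refine (norm_exp_sub_exp_le (hreal _ (by positivity)) (hreal _ hw)).trans ?_
    rw [← mul_sub, norm_mul, ← Complex.ofReal_sub, Complex.norm_real, Real.norm_eq_abs]
    gcongr
    have : ((n - 1 : ℕ) : ℝ) * (m : ℝ)⁻¹ - w = ((n : ℝ) / m - w) - (n : ℝ) / m / n := by
      rw [hk]
      field_simp
      ring
    rw [this]
    refine (abs_sub _ _).trans (add_le_add le_rfl (le_of_eq (abs_of_nonneg (by positivity))))
  calc _ ≤ _ := norm_sub_le_norm_sub_add_norm_sub _ (Complex.exp ((z - 1) / (m : ℂ)) ^ (n - 1)) _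
    _ ≤ _ := add_le_add hstep1 hstep2

theorem norm_integral_exp_degree_sub_le (n : ℕ) [NeZero n] {s w : ℝ} (hs : |s| ≤ 1) (hw : 0 ≤ w) :
    ‖∫ x, Complex.exp (s * vertexDegree n x * Complex.I) ∂(clusterGraphWithVertex n criticalProb) -
        Complex.exp ((Complex.exp (s * Complex.I) - 1) * w)‖ ≤
      s ^ 2 * ((∫ m : ℕ, ((n : ℝ) / m) ^ 2 ∂(stamMeasure n)) / n) +
        |s| * ((∫ m : ℕ, |(n : ℝ) / m - w| ∂(stamMeasure n)) +
          (∫ m : ℕ, (n : ℝ) / m ∂(stamMeasure n)) / n) := by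
  classical
  have h1 : ∫ x, Complex.exp (s * vertexDegree n x * Complex.I)
      ∂(clusterGraphWithVertex n criticalProb) =
      ∫ m : ℕ, (1 + (Complex.exp (s * Complex.I) - 1) / (m : ℂ)) ^ (n - 1) ∂(stamMeasure n) := by
    rw [← integral_pow_degree]
    refine integral_congr_ae (ae_of_all _ fun x => ?_)
    simp only
    rw [← Complex.exp_nat_mul, vertexDegree]
    congr 1
    push_cast
    ring
  have hint : Integrable (fun m : ℕ => (1 + (Complex.exp (s * Complex.I) - 1) / (m : ℂ)) ^ (n - 1))
      (stamMeasure n) :=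
    integrable_stamMeasure_of_bound n ((1 + ‖Complex.exp (s * Complex.I) - 1‖) ^ (n - 1))
      fun m => by
        rw [norm_pow]
        gcongr
        refine (norm_add_le _ _).trans ?_
        rw [norm_one, div_eq_mul_inv, norm_mul]
        gcongr
        exact mul_le_of_le_one_right (norm_nonneg _) (norm_natCast_inv_le_one m)
  have habs : Integrable (fun m : ℕ => |(n : ℝ) / m - w|) (stamMeasure n) :=
    ((integrable_natCast_div n).sub (integrable_const w)).abs
  have h2 : ∫ m : ℕ, (1 + (Complex.exp (s * Complex.I) - 1) / (m : ℂ)) ^ (n - 1) ∂(stamMeasure n) -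
      Complex.exp ((Complex.exp (s * Complex.I) - 1) * w) =
      ∫ m : ℕ, ((1 + (Complex.exp (s * Complex.I) - 1) / (m : ℂ)) ^ (n - 1) -
        Complex.exp ((Complex.exp (s * Complex.I) - 1) * w)) ∂(stamMeasure n) := by
    rw [integral_sub hint (integrable_const _)]
    simp
  have hi1 := ((integrable_natCast_div_sq n).div_const (n : ℝ)).const_mul (s ^ 2)
  have hi2 : Integrable (fun m : ℕ => |s| * (|(n : ℝ) / m - w| + (n : ℝ) / m / n))
      (stamMeasure n) := (habs.add ((integrable_natCast_div n).div_const (n : ℝ))).const_mul |s|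
  rw [h1, h2]
  refine (norm_integral_le_of_norm_le (hi1.add hi2)
    (ae_of_all _ fun m => norm_binomial_sub_poisson_le n m hs hw)).trans (le_of_eq ?_)
  rw [integral_add' hi1 hi2, integral_const_mul, integral_const_mul, integral_div,
    integral_add habs ((integrable_natCast_div n).div_const (n : ℝ)), integral_div]

/-! ### Asymptotics in terms of `W(n)` -/

theorem tendsto_natCast_pnat : Tendsto (fun n : ℕ+ => ((n : ℕ) : ℝ)) atTop atTop :=
  tendsto_natCast_atTop_atTop.comp (tendsto_atTop.mpr fun b =>
    (eventually_ge_atTop b.succPNat).mono fun n hn =>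
      (Nat.le_succ b).trans (show (b.succPNat : ℕ) ≤ n from hn))

theorem tendsto_lambertW : Tendsto lambertW atTop atTop := by
  refine tendsto_atTop.mpr fun K => ?_
  filter_upwards [tendsto_natCast_pnat.eventually_gt_atTop (|K| * Real.exp |K|)] with n hn
  obtain ⟨h0, h1⟩ := lambertW_spec n
  by_contra! h
  rw [← h1] at hn
  have h2 : lambertW n ≤ |K| := h.le.trans (le_abs_self K)
  exact absurd hn (not_lt.mpr (by gcongr))

/-- Dividing by `n = w * exp w` cancels one power of `w` and leaves `w ^ k * exp (-w)`. -/
theorem tendsto_lambertW_pow_div (k : ℕ) :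
    Tendsto (fun n : ℕ+ => lambertW n ^ (k + 1) / ((n : ℕ) : ℝ)) atTop (𝓝 0) := by
  have h := (Real.tendsto_pow_mul_exp_neg_atTop_nhds_zero k).comp tendsto_lambertW
  refine h.congr fun n => ?_
  obtain ⟨h0, h1⟩ := lambertW_spec n
  rw [← h1, Function.comp_apply, Real.exp_neg]
  field_simp
  ring

/-- The mean square error in the approximation of `n / m` by `W(n)`. -/
def meanSqError (n : ℕ+) : ℝ :=
  ∫ m : ℕ, (((n : ℕ) : ℝ) / m - lambertW n) ^ 2 ∂(stamMeasure n)

/-- The mean absolute error in the approximation of `n / m` by `W(n)`. -/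
def meanAbsError (n : ℕ+) : ℝ :=
  ∫ m : ℕ, |((n : ℕ) : ℝ) / m - lambertW n| ∂(stamMeasure n)

theorem tendsto_meanSqError : Tendsto meanSqError atTop (𝓝 0) := by
  have h := (tendsto_lambertW_pow_div 3).const_mul 10
  rw [mul_zero] at h
  refine tendsto_of_tendsto_of_tendsto_of_le_of_le' tendsto_const_nhds h
    (.of_forall fun n => integral_nonneg fun m => sq_nonneg _) ?_
  filter_upwards [tendsto_lambertW.eventually_ge_atTop 4] with n hn
  rw [← mul_div_assoc]
  exact integral_sq_sub_le n hn (lambertW_spec n).2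

theorem meanAbsError_nonneg (n : ℕ+) : 0 ≤ meanAbsError n := integral_nonneg fun _ => abs_nonneg _

theorem tendsto_meanAbsError : Tendsto meanAbsError atTop (𝓝 0) := by
  have h := tendsto_meanSqError.sqrt
  rw [Real.sqrt_zero] at h
  exact squeeze_zero meanAbsError_nonneg
    (fun n => Real.le_sqrt_of_sq_le (integral_abs_sub_sq_le n _)) h

theorem tendsto_integral_natCast_div_div :
    Tendsto (fun n : ℕ+ => (∫ m : ℕ, ((n : ℕ) : ℝ) / m ∂(stamMeasure n)) / ((n : ℕ) : ℝ))
      atTop (𝓝 0) := by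
  have h := (tendsto_lambertW_pow_div 0).add
    (tendsto_meanAbsError.div_atTop tendsto_natCast_pnat)
  rw [add_zero] at h
  refine squeeze_zero (fun n => div_nonneg (integral_nonneg fun m => by positivity)
    (Nat.cast_nonneg _)) (fun n => ?_) h
  rw [zero_add, pow_one, ← add_div]
  gcongr
  have := (abs_le.mp (abs_integral_natCast_div_sub_le n (lambertW n))).2
  rw [meanAbsError]
  linarith

theorem tendsto_integral_natCast_div_sq_div :
    Tendsto (fun n : ℕ+ => (∫ m : ℕ, (((n : ℕ) : ℝ) / m) ^ 2 ∂(stamMeasure n)) / ((n : ℕ) : ℝ))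
      atTop (𝓝 0) := by
  have h := ((tendsto_meanSqError.div_atTop tendsto_natCast_pnat).add
    (tendsto_lambertW_pow_div 1)).add
    (((tendsto_lambertW_pow_div 0).mul tendsto_meanAbsError).const_mul 2)
  simp only [mul_zero, add_zero, zero_add, pow_one] at h
  refine squeeze_zero (fun n => div_nonneg (integral_nonneg fun m => by positivity)
    (Nat.cast_nonneg _)) (fun n => ?_) h
  have h1 := (abs_le.mp (abs_integral_natCast_div_sub_le n (lambertW n))).2
  have h2 := integral_sq_sub_eq n (lambertW n)
  have h3 := (lambertW_spec n).1
  rw [← meanAbsError] at h1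
  rw [← meanSqError] at h2
  have h4 : meanSqError n / ((n : ℕ) : ℝ) + lambertW n ^ (1 + 1) / ((n : ℕ) : ℝ) +
      2 * (lambertW n / ((n : ℕ) : ℝ) * meanAbsError n) =
      (meanSqError n + lambertW n ^ 2 + 2 * (lambertW n * meanAbsError n)) / ((n : ℕ) : ℝ) := by
    ring
  rw [h4]
  refine div_le_div_of_nonneg_right ?_ (Nat.cast_nonneg _)
  nlinarith

theorem tendsto_degreeMean_sub :
    Tendsto (fun n : ℕ+ => degreeMean n criticalProb - lambertW n) atTop (𝓝 0) := by
  have h := tendsto_meanAbsError.add ((tendsto_lambertW_pow_div 0).add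
    (tendsto_meanAbsError.div_atTop tendsto_natCast_pnat))
  simp only [zero_add, pow_one, ← add_div] at h
  exact squeeze_zero_norm (fun n => abs_degreeMean_sub_le n (le_refl (meanAbsError n))) h

theorem tendsto_degreeVar_sub :
    Tendsto (fun n : ℕ+ => degreeVar n criticalProb - lambertW n) atTop (𝓝 0) := by
  have h := tendsto_meanSqError.add tendsto_integral_natCast_div_sq_div
  rw [add_zero] at h
  have h1 : Tendsto (fun n : ℕ+ => degreeVar n criticalProb - degreeMean n criticalProb)
      atTop (𝓝 0) := by
    refine squeeze_zero_norm' ?_ h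
    filter_upwards [tendsto_natCast_pnat.eventually_ge_atTop 2] with n hn
    exact abs_degreeVar_sub_degreeMean_le n (by exact_mod_cast hn) (lambertW n)
  have h2 := h1.add tendsto_degreeMean_sub
  simpa using h2

theorem isEquivalent_of_tendsto_sub_zero {ι : Type*} {l : Filter ι} {u v : ι → ℝ}
    (h : Tendsto (fun i => u i - v i) l (𝓝 0)) (hv : Tendsto v l atTop) :
    Asymptotics.IsEquivalent l u v :=
  ((Asymptotics.isLittleO_one_iff ℝ).mpr h).trans
    (Asymptotics.isLittleO_const_left.mpr (Or.inr (tendsto_norm_atTop_atTop.comp hv)))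

theorem tendsto_degreeVar : Tendsto (fun n : ℕ+ => degreeVar n criticalProb) atTop atTop := by
  have h := tendsto_degreeVar_sub.add_atTop tendsto_lambertW
  simpa using h

/-! ### The normal limit -/

theorem norm_exp_mul_I_sub_taylor_le {s : ℝ} (hs : |s| ≤ 1) :
    ‖Complex.exp (s * Complex.I) - 1 - s * Complex.I + s ^ 2 / 2‖ ≤ |s| ^ 3 := by
  have hn : ‖(s : ℂ) * Complex.I‖ = |s| := by simp
  have h := Complex.exp_bound (x := (s : ℂ) * Complex.I) (by rw [hn]; exact hs) (n := 3) (by norm_num)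
  rw [hn] at h
  have h1 : Complex.exp (s * Complex.I) - 1 - s * Complex.I + s ^ 2 / 2 =
      Complex.exp (s * Complex.I) -
        ∑ m ∈ Finset.range 3, ((s : ℂ) * Complex.I) ^ m / (m.factorial : ℂ) := by
    simp [Finset.sum_range_succ, mul_pow, Nat.factorial]
    ring
  rw [h1]
  refine h.trans (mul_le_of_le_one_right (by positivity) ?_)
  norm_num [Nat.factorial]

/-- The cumulant asymptotics of a Poisson variable whose mean tends to infinity. -/
theorem tendsto_poisson_exponent {ι : Type*} {l : Filter ι} {w μ v : ι → ℝ}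
    (hw : Tendsto w l atTop) (hμ : Tendsto (fun i => μ i - w i) l (𝓝 0))
    (hv : Tendsto (fun i => v i - w i) l (𝓝 0)) (t : ℝ) :
    Tendsto (fun i => (Complex.exp ((t / √(v i) : ℝ) * Complex.I) - 1) * (w i : ℂ) -
      (t / √(v i) : ℝ) * μ i * Complex.I) l (𝓝 (-t ^ 2 / 2)) := by
  set s : ι → ℝ := fun i => t / √(v i) with hs
  have hvtop : Tendsto v l atTop := by simpa using hv.add_atTop hw
  have hs0 : Tendsto s l (𝓝 0) :=
    tendsto_const_nhds.div_atTop (Real.tendsto_sqrt_atTop.comp hvtop)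
  have hsw : Tendsto (fun i => s i ^ 2 * w i) l (𝓝 (t ^ 2)) := by
    -- Once `v` is positive, `s ^ 2 * w = t ^ 2 * w / v`, and `w / v = 1 - (v - w) / v`.
    have h1 : Tendsto (fun i => t ^ 2 - t ^ 2 * ((v i - w i) / v i)) l (𝓝 (t ^ 2 - t ^ 2 * 0)) :=
      tendsto_const_nhds.sub ((hv.div_atTop hvtop).const_mul _)
    rw [mul_zero, sub_zero] at h1
    refine h1.congr' ?_
    filter_upwards [hvtop.eventually_gt_atTop 0] with i hi
    simp only [hs]
    rw [div_pow, Real.sq_sqrt hi.le]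
    field_simp
    ring
  have hs1 : ∀ᶠ i in l, |s i| ≤ 1 := by
    have := hs0.abs
    rw [abs_zero] at this
    exact this.eventually_le_const one_pos
  have hR : Tendsto (fun i => (Complex.exp (s i * Complex.I) - 1 - s i * Complex.I + s i ^ 2 / 2) *
      (w i : ℂ)) l (𝓝 0) := by
    have h1 : Tendsto (fun i => |s i| * (s i ^ 2 * w i)) l (𝓝 0) := by
      have := hs0.abs.mul hsw
      rwa [abs_zero, zero_mul] at this
    refine squeeze_zero_norm' ?_ h1
    filter_upwards [hs1, hw.eventually_ge_atTop 0] with i hi hwi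
    rw [norm_mul, Complex.norm_real, Real.norm_of_nonneg hwi]
    calc _ ≤ |s i| ^ 3 * w i := by
          gcongr
          exact norm_exp_mul_I_sub_taylor_le hi
      _ = |s i| * (s i ^ 2 * w i) := by
          rw [← sq_abs (s i)]
          ring
  have hL : Tendsto (fun i => ((s i * (μ i - w i) : ℝ) : ℂ) * Complex.I) l (𝓝 0) := by
    have h1 := hs0.mul hμ
    rw [mul_zero] at h1
    have h2 := (Complex.continuous_ofReal.tendsto 0).comp h1
    simpa using h2.mul_const Complex.I
  have hQ : Tendsto (fun i => ((s i ^ 2 * w i : ℝ) : ℂ) / 2) l (𝓝 ((t ^ 2 : ℝ) / 2)) :=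
    ((Complex.continuous_ofReal.tendsto _).comp hsw).div_const 2
  -- The exponent is the Taylor remainder times `w`, minus `s * (μ - w) * I`, minus `s ^ 2 * w / 2`;
  -- only the last part survives in the limit.
  have h := (hR.sub hL).sub hQ
  rw [sub_zero, zero_sub] at h
  have hlim : -(((t ^ 2 : ℝ) : ℂ) / 2) = -(t : ℂ) ^ 2 / 2 := by
    push_cast
    ring
  rw [hlim] at h
  refine h.congr fun i => ?_
  change _ = (Complex.exp (s i * Complex.I) - 1) * (w i : ℂ) - s i * μ i * Complex.I
  push_cast
  ring

theorem tendsto_charFun_vertexDegree (t : ℝ) :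
    Tendsto (fun n : ℕ+ => charFun ((clusterGraphWithVertex n criticalProb).map fun x =>
      (vertexDegree n x - degreeMean n criticalProb) / √(degreeVar n criticalProb)) t)
      atTop (𝓝 (Complex.exp (-t ^ 2 / 2))) := by
  set s : ℕ+ → ℝ := fun n => t / √(degreeVar n criticalProb) with hs
  have hs0 : Tendsto s atTop (𝓝 0) :=
    tendsto_const_nhds.div_atTop (Real.tendsto_sqrt_atTop.comp tendsto_degreeVar)
  have hs1 : ∀ᶠ n in atTop, |s n| ≤ 1 := by
    have := hs0.abs
    rw [abs_zero] at this
    exact this.eventually_le_const one_pos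
  have hmain := (Complex.continuous_exp.tendsto _).comp
    (tendsto_poisson_exponent tendsto_lambertW tendsto_degreeMean_sub tendsto_degreeVar_sub t)
  have herr : Tendsto (fun n : ℕ+ =>
      s n ^ 2 * ((∫ m : ℕ, (((n : ℕ) : ℝ) / m) ^ 2 ∂(stamMeasure n)) / ((n : ℕ) : ℝ)) +
        |s n| * (meanAbsError n +
          (∫ m : ℕ, ((n : ℕ) : ℝ) / m ∂(stamMeasure n)) / ((n : ℕ) : ℝ))) atTop (𝓝 0) := by
    have h := ((hs0.pow 2).mul tendsto_integral_natCast_div_sq_div).add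
      (hs0.abs.mul (tendsto_meanAbsError.add tendsto_integral_natCast_div_div))
    simpa using h
  have hchar : ∀ n : ℕ+, charFun ((clusterGraphWithVertex n criticalProb).map fun x =>
      (vertexDegree n x - degreeMean n criticalProb) / √(degreeVar n criticalProb)) t =
      Complex.exp (-(s n * degreeMean n criticalProb * Complex.I)) *
        ∫ x, Complex.exp (s n * vertexDegree n x * Complex.I)
          ∂(clusterGraphWithVertex n criticalProb) := by
    intro n
    rw [charFun_apply_real, integral_map (measurable_of_finite _).aemeasurable (by fun_prop),
      ← integral_const_mul]
    refine integral_congr_ae (ae_of_all _ fun x => ?_)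
    simp only [hs]
    rw [← Complex.exp_add]
    congr 1
    push_cast
    ring
  have hdiff : Tendsto (fun n : ℕ+ => charFun ((clusterGraphWithVertex n criticalProb).map fun x =>
      (vertexDegree n x - degreeMean n criticalProb) / √(degreeVar n criticalProb)) t -
      Complex.exp ((Complex.exp (s n * Complex.I) - 1) * (lambertW n : ℂ) -
        s n * degreeMean n criticalProb * Complex.I)) atTop (𝓝 0) := by
    refine squeeze_zero_norm' ?_ herr
    filter_upwards [hs1] with n hn
    rw [hchar, sub_eq_neg_add ((Complex.exp (s n * Complex.I) - 1) * (lambertW n : ℂ)),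
      Complex.exp_add, ← mul_sub, norm_mul]
    have h1 : ‖Complex.exp (-(s n * degreeMean n criticalProb * Complex.I))‖ = 1 := by
      have := Complex.norm_exp_ofReal_mul_I (-(s n * degreeMean n criticalProb))
      rwa [Complex.ofReal_neg, Complex.ofReal_mul, neg_mul] at this
    rw [h1, one_mul]
    exact norm_integral_exp_degree_sub_le n hn (lambertW_spec n).1.le
  have h := hdiff.add hmain
  rw [zero_add] at h
  refine h.congr fun n => ?_
  simp [hs]

end RandomCluster

end


theorem corollary1p4 :
    TendstoInDistribution
      (fun (n : ℕ+) (x : SimpleGraph (Fin n) × Fin n) =>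
        (RandomCluster.vertexDegree n x - RandomCluster.degreeMean n RandomCluster.criticalProb) /
          Real.sqrt (RandomCluster.degreeVar n RandomCluster.criticalProb))
      atTop (id : ℝ → ℝ)
      (fun n : ℕ+ => RandomCluster.clusterGraphWithVertex n RandomCluster.criticalProb)
      (gaussianReal 0 1) ∧
    Asymptotics.IsEquivalent atTop
      (fun n : ℕ+ => RandomCluster.degreeMean n RandomCluster.criticalProb)
      RandomCluster.lambertW ∧
    Asymptotics.IsEquivalent atTop
      (fun n : ℕ+ => RandomCluster.degreeVar n RandomCluster.criticalProb)
      RandomCluster.lambertW := by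
  refine ⟨⟨fun n => (measurable_of_finite _).aemeasurable, aemeasurable_id, ?_⟩,
    RandomCluster.isEquivalent_of_tendsto_sub_zero RandomCluster.tendsto_degreeMean_sub
      RandomCluster.tendsto_lambertW,
    RandomCluster.isEquivalent_of_tendsto_sub_zero RandomCluster.tendsto_degreeVar_sub
      RandomCluster.tendsto_lambertW⟩
  -- The index set is transported from `ℕ+` to `ℕ`, so that the continuity theorem is applied to an
  -- ordinary sequence.
  rw [← OrderIso.pnatIsoNat.symm.map_atTop]
  refine tendsto_map'_iff.mpr ?_
  refine ProbabilityMeasure.tendsto_of_tendsto_charFun fun t => ?_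
  have h := (RandomCluster.tendsto_charFun_vertexDegree t).comp
    OrderIso.pnatIsoNat.symm.tendsto_atTop
  have hg : charFun (Measure.map id (gaussianReal 0 1)) t = Complex.exp (-t ^ 2 / 2) := by
    rw [Measure.map_id, charFun_gaussianReal]
    simp [neg_div]
  rw [← hg] at h
  exact h
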